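/- Let $n\ge 1$. For a homogeneous space $G/K$ of a Lie group $G$, write $C^\infty(G/K)$ for its complex-valued smooth functions, $\tau_g$ for the translation of $G/K$ by $g\in G$, and $\mathbb D(G/K)$ for the $\mathbb C$-algebra (under composition) of $G$-invariant differential operators on $G/K$, i.e. of the linear differential operators $D\colon C^\infty(G/K)\to C^\infty(G/K)$ with smooth complex coefficients such that $D(f\circ\tau_g)=(Df)\circ\tau_g$ for all $g\in G$ and $f\in C^\infty(G/K)$. Let $$i\colon \mathrm{SL}_n(\mathbb R)/\mathrm{SO}_n(\mathbb R)\to \mathrm{GL}_n(\mathbb R)/\mathrm{O}_n(\mathbb R),\qquad g\,\mathrm{SO}_n(\mathbb R)\mapsto g\,\mathrm{O}_n(\mathbb R),$$ and let $$p\colon \mathrm{GL}_n(\mathbb R)/\mathrm{O}_n(\mathbb R)\to \mathrm{SL}_n(\mathbb R)/\mathrm{SO}_n(\mathbb R),\qquad g\,\mathrm{O}_n(\mathbb R)\mapsto \det(g)^{-1/n}g\,\mathrm{SO}_n(\mathbb R)\quad\text{for } \det(g)>0,$$ where every coset in $\mathrm{GL}_n(\mathbb R)/\mathrm{O}_n(\mathbb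 R)$ has a representative $g$ with $\det(g)>0$, unique up to right multiplication by $\mathrm{SO}_n(\mathbb R)$. Then the formula $$P(D)f = D(f\circ p)\circ i,\qquad D\in\mathbb D(\mathrm{GL}_n(\mathbb R)/\mathrm{O}_n(\mathbb R)),\ f\in C^\infty(\mathrm{SL}_n(\mathbb R)/\mathrm{SO}_n(\mathbb R)),$$ defines a morphism of unital $\mathbb C$-algebras $P\colon \mathbb D(\mathrm{GL}_n(\mathbb R)/\mathrm{O}_n(\mathbb R))\to\mathbb D(\mathrm{SL}_n(\mathbb R)/\mathrm{SO}_n(\mathbb R))$. Furthermore, $$(P(D)f)\circ p = D(f\circ p)$$ for all $D\in\mathbb D(\mathrm{GL}_n(\mathbb R)/\mathrm{O}_n(\mathbb R))$ and $f\in C^\infty(\mathrm{SL}_n(\mathbb R)/\mathrm{SO}_n(\mathbb R))$. -/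

import Mathlib

open scoped ContDiff

noncomputable section

namespace SymmetricSpace

/-! ### Linear partial differential operators on open subsets of a vector space -/

section Local

variable {E : Type*} [NormedAddCommGroup E] [NormedSpace ℝ E]

/-- On the open set `U`, the operator `T` is a linear partial differential operator of finite order
with smooth complex coefficients: `T φ` is on `U` a finite sum of terms `a • ∂_{v₁} ⋯ ∂_{vₖ} φ`, where
`∂_w` is the derivative in the direction `w`; the `j`-th term has coefficient `a j`, order `(d j).1`
and directions `(d j).2`. The argument runs over a type `S` of smooth functions, with `ev` turning an
element of `S` into a function on `E`. -/
def IsPDOOn (U : Set E) {S : Type*} (ev : S → E → ℂ) (T : S → E → ℂ) : Prop :=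
  ∃ (m : ℕ) (d : Fin m → Σ k : ℕ, Fin k → E) (a : Fin m → E → ℂ),
    (∀ j, ContDiffOn ℝ ∞ (a j) U) ∧
    ∀ φ : S, ∀ X ∈ U, T φ X = ∑ j, a j X * iteratedFDeriv ℝ (d j).1 (ev φ) X (d j).2

variable {U V : Set E} {S : Type*} {ev : S → E → ℂ}

lemma IsPDOOn.congr {T T' : S → E → ℂ} (h : IsPDOOn U ev T)
    (h' : ∀ φ, ∀ X ∈ U, T' φ X = T φ X) : IsPDOOn U ev T' := by
  obtain ⟨m, d, a, ha, hT⟩ := h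
  exact ⟨m, d, a, ha, fun φ X hX => (h' φ X hX).trans (hT φ X hX)⟩

lemma IsPDOOn.mono {T : S → E → ℂ} (h : IsPDOOn U ev T) (hV : V ⊆ U) : IsPDOOn V ev T := by
  obtain ⟨m, d, a, ha, hT⟩ := h
  exact ⟨m, d, a, fun j => (ha j).mono hV, fun φ X hX => hT φ X (hV hX)⟩

lemma IsPDOOn.zero : IsPDOOn U ev (fun _ _ => 0) :=
  ⟨0, fun j => j.elim0, fun j => j.elim0, fun j => j.elim0, by simp⟩

lemma IsPDOOn.single (k : ℕ) (v : Fin k → E) {a : E → ℂ} (ha : ContDiffOn ℝ ∞ a U) :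
    IsPDOOn U ev (fun φ X => a X * iteratedFDeriv ℝ k (ev φ) X v) :=
  ⟨1, fun _ => ⟨k, v⟩, fun _ => a, fun _ => ha, by simp⟩

lemma IsPDOOn.add {T T' : S → E → ℂ} (h : IsPDOOn U ev T) (h' : IsPDOOn U ev T') :
    IsPDOOn U ev (fun φ X => T φ X + T' φ X) := by
  obtain ⟨m, d, a, ha, hT⟩ := h
  obtain ⟨m', d', a', ha', hT'⟩ := h'
  refine ⟨m + m', Fin.append d d', Fin.append a a', fun j => ?_, fun φ X hX => ?_⟩
  · refine Fin.addCases (fun i => ?_) (fun i => ?_) j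
    · simpa using ha i
    · simpa using ha' i
  · simp only [hT φ X hX, hT' φ X hX, Fin.sum_univ_add]
    congr 1 <;> refine Finset.sum_congr rfl fun i _ => ?_
    · rw [Fin.append_left, Fin.append_left]
    · rw [Fin.append_right, Fin.append_right]

lemma IsPDOOn.sum {ι : Type*} (s : Finset ι) {T : ι → S → E → ℂ}
    (h : ∀ i ∈ s, IsPDOOn U ev (T i)) : IsPDOOn U ev (fun φ X => ∑ i ∈ s, T i φ X) := by
  classical
  induction s using Finset.induction_on with
  | empty => simpa using IsPDOOn.zero
  | insert i s hi ih =>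
    have h1 := (h i (by simp)).add (ih fun j hj => h j (by simp [hj]))
    exact h1.congr fun φ X _ => by simp [Finset.sum_insert hi]

lemma IsPDOOn.smooth_mul {T : S → E → ℂ} (h : IsPDOOn U ev T) {b : E → ℂ}
    (hb : ContDiffOn ℝ ∞ b U) : IsPDOOn U ev (fun φ X => b X * T φ X) := by
  obtain ⟨m, d, a, ha, hT⟩ := h
  refine ⟨m, d, fun j X => b X * a j X, fun j => hb.mul (ha j), fun φ X hX => ?_⟩
  simp only [hT φ X hX, Finset.mul_sum, mul_assoc]

lemma contDiff_iteratedFDeriv_apply {f : E → ℂ} (hf : ContDiff ℝ ∞ f) (k : ℕ) (v : Fin k → E) :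
    ContDiff ℝ ∞ (fun X => iteratedFDeriv ℝ k f X v) := by
  have h1 : ContDiff ℝ ∞ (iteratedFDeriv ℝ k f) := hf.iteratedFDeriv_right (m := ∞) le_rfl
  exact (ContinuousMultilinearMap.apply ℝ (fun _ : Fin k => E) ℂ v).contDiff.comp h1

lemma IsPDOOn.fderiv_apply (hU : IsOpen U) (hev : ∀ φ, ContDiff ℝ ∞ (ev φ)) {T : S → E → ℂ}
    (h : IsPDOOn U ev T) (w : E) : IsPDOOn U ev (fun φ X => fderiv ℝ (T φ) X w) := by
  obtain ⟨m, d, a, ha, hT⟩ := h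
  have key : IsPDOOn U ev (fun φ X => ∑ j,
      ((fderiv ℝ (a j) X w) * iteratedFDeriv ℝ (d j).1 (ev φ) X (d j).2 +
        a j X * iteratedFDeriv ℝ ((d j).1 + 1) (ev φ) X (Fin.cons w (d j).2))) := by
    refine IsPDOOn.sum _ fun j _ => (IsPDOOn.single _ _ ?_).add (IsPDOOn.single _ _ (ha j))
    exact ((ha j).fderiv_of_isOpen hU (by simp)).clm_apply contDiffOn_const
  refine key.congr fun φ X hX => ?_
  have hE : T φ =ᶠ[nhds X] fun Y => ∑ j, a j Y * iteratedFDeriv ℝ (d j).1 (ev φ) Y (d j).2 := by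
    filter_upwards [hU.mem_nhds hX] with Y hY using hT φ Y hY
  have hd1 : ∀ j, DifferentiableAt ℝ (a j) X := fun j =>
    ((ha j).contDiffAt (hU.mem_nhds hX)).differentiableAt (by simp)
  have hd2 : ∀ j, DifferentiableAt ℝ (fun Y => iteratedFDeriv ℝ (d j).1 (ev φ) Y (d j).2) X :=
    fun j => (contDiff_iteratedFDeriv_apply (hev φ) _ _).contDiffAt.differentiableAt (by simp)
  have hd3 : ∀ j, DifferentiableAt ℝ (iteratedFDeriv ℝ (d j).1 (ev φ)) X := fun j =>
    ((hev φ).iteratedFDeriv_right (m := ∞) le_rfl).contDiffAt.differentiableAt (by simp)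
  rw [hE.fderiv_eq, fderiv_fun_sum (fun j _ => (hd1 j).fun_mul (hd2 j))]
  rw [sum_apply]
  refine Finset.sum_congr rfl fun j _ => ?_
  rw [fderiv_fun_mul (hd1 j) (hd2 j), iteratedFDeriv_succ_apply_left]
  have := fderiv_continuousMultilinear_apply_const_apply (hd3 j) (d j).2 w
  simp only [add_apply, smul_apply, smul_eq_mul,
    Fin.cons_zero, Fin.tail_cons, this]
  ring

lemma IsPDOOn.iteratedFDeriv_apply (hU : IsOpen U) (hev : ∀ φ, ContDiff ℝ ∞ (ev φ))
    {T : S → E → ℂ} (hTs : ∀ φ, ContDiff ℝ ∞ (T φ)) (h : IsPDOOn U ev T) (k : ℕ)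
    (v : Fin k → E) : IsPDOOn U ev (fun φ X => iteratedFDeriv ℝ k (T φ) X v) := by
  induction k with
  | zero => exact h.congr fun φ X _ => by simp
  | succ k ih =>
    refine ((ih (Fin.tail v)).fderiv_apply hU hev (v 0)).congr fun φ X _ => ?_
    have hd : DifferentiableAt ℝ (iteratedFDeriv ℝ k (T φ)) X :=
      ((hTs φ).iteratedFDeriv_right (m := ∞) le_rfl).contDiffAt.differentiableAt (by simp)
    rw [iteratedFDeriv_succ_apply_left,
      fderiv_continuousMultilinear_apply_const_apply hd (Fin.tail v) (v 0)]

end Local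

/-! ### Smooth functions and invariant differential operators on a homogeneous space

`G ⧸ K` is a homogeneous space with a manifold structure for which, for every `g`, the map
`X ↦ g * e X * K` from the vector space `E` is a (global) chart centred at `g K`. For the Riemannian
symmetric spaces below, `E = 𝔭` is the complement of `𝔨` in the Cartan decomposition, `e = exp`,
and these maps are diffeomorphisms of `𝔭` onto `G ⧸ K`. -/

section Homogeneous

variable {G : Type*} [Group G] (K : Subgroup G)
  {E : Type*} [NormedAddCommGroup E] [NormedSpace ℝ E] (e : E → G)

/-- `C^∞(G/K)`: the complex valued functions that are smooth in every chart `X ↦ g * e X * K`. -/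
def smoothFn : Submodule ℂ (G ⧸ K → ℂ) where
  carrier := {f | ∀ g : G, ContDiff ℝ ∞ (fun X : E => f (QuotientGroup.mk (g * e X)))}
  add_mem' hf hf' g := (hf g).add (hf' g)
  zero_mem' _ := contDiff_const
  smul_mem' _ _ hf g := contDiff_const.mul (hf g)

/-- The expression of the smooth function `f` in the chart centred at `g K`. -/
def inChart (g : G) (f : smoothFn K e) (X : E) : ℂ := f.1 (QuotientGroup.mk (g * e X))

lemma contDiff_inChart (g : G) (f : smoothFn K e) : ContDiff ℝ ∞ (inChart K e g f) := f.2 g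

/-- `D` is a differential operator on `G/K`: around each point `g K`, in the chart centred there,
it is a linear partial differential operator with smooth coefficients. -/
def IsDiffOp (D : Module.End ℂ (smoothFn K e)) : Prop :=
  ∀ g : G, ∃ U : Set E, IsOpen U ∧ 0 ∈ U ∧
    IsPDOOn U (inChart K e g) (fun f => inChart K e g (D f))

/-- `f ∘ τ_g`, where `τ_g` is the translation by `g` on `G/K`. -/
def translate (g : G) (f : smoothFn K e) : smoothFn K e :=
  ⟨fun x => f.1 (g • x), fun h => by
    have h1 := f.2 (g * h)
    simp only [mul_assoc] at h1
    exact h1⟩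

/-- `𝔻(G/K)`: the algebra of `G`-invariant differential operators on `G/K`, i.e. those with
`D (f ∘ τ_g) = (D f) ∘ τ_g` for all `g`; the product is the composition. -/
def invDiffOp : Subalgebra ℂ (Module.End ℂ (smoothFn K e)) where
  carrier := {D | IsDiffOp K e D ∧
    ∀ (g : G) (f : smoothFn K e), D (translate K e g f) = translate K e g (D f)}
  add_mem' := by
    rintro D D' ⟨hD, hi⟩ ⟨hD', hi'⟩
    refine ⟨fun g => ?_, fun g f => ?_⟩
    · obtain ⟨U, hU, h0, h⟩ := hD g
      obtain ⟨U', hU', h0', h'⟩ := hD' g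
      exact ⟨U ∩ U', hU.inter hU', ⟨h0, h0'⟩,
        (h.mono Set.inter_subset_left).add (h'.mono Set.inter_subset_right)⟩
    · rw [LinearMap.add_apply, LinearMap.add_apply, hi, hi']
      rfl
  mul_mem' := by
    rintro D D' ⟨hD, hi⟩ ⟨hD', hi'⟩
    refine ⟨fun g => ?_, fun g f => ?_⟩
    · obtain ⟨U, hU, h0, m, d, a, ha, h⟩ := hD g
      obtain ⟨U', hU', h0', h'⟩ := hD' g
      refine ⟨U ∩ U', hU.inter hU', ⟨h0, h0'⟩, ?_⟩
      have key : IsPDOOn (U ∩ U') (inChart K e g) (fun f X => ∑ j, a j X *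
          iteratedFDeriv ℝ (d j).1 (inChart K e g (D' f)) X (d j).2) :=
        IsPDOOn.sum _ fun j _ =>
          ((h'.mono Set.inter_subset_right).iteratedFDeriv_apply (hU.inter hU')
            (contDiff_inChart K e g) (fun f => contDiff_inChart K e g (D' f)) (d j).1
            (d j).2).smooth_mul ((ha j).mono Set.inter_subset_left)
      exact key.congr fun f X hX => h (D' f) X hX.1
    · rw [Module.End.mul_apply, Module.End.mul_apply, hi', hi]
  algebraMap_mem' c := by
    refine ⟨fun g => ⟨Set.univ, isOpen_univ, trivial, ?_⟩, fun g f => rfl⟩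
    have h := IsPDOOn.single (U := Set.univ) (ev := inChart K e g) 0 Fin.elim0
      (contDiffOn_const (c := c))
    exact h.congr fun f X _ => by
      rw [iteratedFDeriv_zero_apply]
      rfl

end Homogeneous

/-! ### The spaces `GL_n(ℝ)/O_n(ℝ)` and `SL_n(ℝ)/SO_n(ℝ)` -/

section Groups

open Matrix

variable (n : ℕ)

/-- The orthogonal group `O_n(ℝ)` as a subgroup of `GL_n(ℝ)`. -/
def On : Subgroup (GL (Fin n) ℝ) where
  carrier := {g | (g : Matrix (Fin n) (Fin n) ℝ) ∈ orthogonalGroup (Fin n) ℝ}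
  mul_mem' ha hb := by
    simpa using mul_mem ha hb
  one_mem' := by
    simp
  inv_mem' := by
    intro g hg
    have h1 : ((g⁻¹ : GL (Fin n) ℝ) : Matrix (Fin n) (Fin n) ℝ) =
        (g : Matrix (Fin n) (Fin n) ℝ)ᵀ := by
      rw [coe_units_inv]
      exact inv_eq_left_inv ((mem_orthogonalGroup_iff' _ _).1 hg)
    change ((g⁻¹ : GL (Fin n) ℝ) : Matrix (Fin n) (Fin n) ℝ) ∈ orthogonalGroup (Fin n) ℝ
    rw [h1, mem_orthogonalGroup_iff, transpose_transpose]
    exact (mem_orthogonalGroup_iff' _ _).1 hg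

/-- The special orthogonal group `SO_n(ℝ)` as a subgroup of `SL_n(ℝ)`
(the condition `det = 1` is automatic). -/
def SOn : Subgroup (SpecialLinearGroup (Fin n) ℝ) := (On n).comap SpecialLinearGroup.toGL

/-- The special orthogonal group `SO_n(ℝ)` as a subgroup of `GL_n^+(ℝ)`
(the condition `det = 1` is automatic). -/
def SOnPos : Subgroup (GLPos (Fin n) ℝ) := (On n).comap (GLPos (Fin n) ℝ).subtype

variable {n} in
lemma det_sq_of_mem_On {g : GL (Fin n) ℝ} (hg : g ∈ On n) :
    (g : Matrix (Fin n) (Fin n) ℝ).det ^ 2 = 1 := by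
  have h : (g : Matrix (Fin n) (Fin n) ℝ) * (g : Matrix (Fin n) (Fin n) ℝ)ᵀ = 1 :=
    (mem_orthogonalGroup_iff _ _).1 hg
  have h2 := congrArg Matrix.det h
  rwa [det_mul, det_transpose, det_one, ← sq] at h2

variable {n} in
lemma mem_SOn_iff (g : SpecialLinearGroup (Fin n) ℝ) :
    g ∈ SOn n ↔ (g : Matrix (Fin n) (Fin n) ℝ) ∈ specialOrthogonalGroup (Fin n) ℝ := by
  rw [mem_specialOrthogonalGroup_iff]
  exact ⟨fun h => ⟨h, g.2⟩, fun h => h.1⟩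

variable {n} in
lemma mem_SOnPos_iff (g : GLPos (Fin n) ℝ) :
    g ∈ SOnPos n ↔ (g.1 : Matrix (Fin n) (Fin n) ℝ) ∈ specialOrthogonalGroup (Fin n) ℝ := by
  rw [mem_specialOrthogonalGroup_iff]
  refine ⟨fun h => ⟨h, ?_⟩, fun h => h.1⟩
  have h1 := det_sq_of_mem_On (show g.1 ∈ On n from h)
  have h2 : 0 < (g.1 : Matrix (Fin n) (Fin n) ℝ).det := g.2
  nlinarith

/-- The space `Sym_n(ℝ)` of symmetric matrices, i.e. the space `𝔭` for `GL_n(ℝ)`. -/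
def Sym : Submodule ℝ (Matrix (Fin n) (Fin n) ℝ) where
  carrier := {X | X.IsSymm}
  add_mem' := IsSymm.add
  zero_mem' := isSymm_zero
  smul_mem' c _ h := IsSymm.smul h c

/-- The space of symmetric matrices of trace zero, i.e. the space `𝔭` for `SL_n(ℝ)`. -/
def SSym : Submodule ℝ (Matrix (Fin n) (Fin n) ℝ) :=
  Sym n ⊓ LinearMap.ker (traceLinearMap (Fin n) ℝ ℝ)

variable {n}

lemma det_exp_of_isSymm {X : Matrix (Fin n) (Fin n) ℝ} (hX : X.IsSymm) :
    (NormedSpace.exp X).det = Real.exp X.trace := by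
  have hH : X.IsHermitian := by
    rw [IsHermitian, conjTranspose_eq_transpose_of_trivial]
    exact hX
  have hs := hH.spectral_theorem
  rw [Unitary.conjStarAlgAut_apply] at hs
  set V : Matrix (Fin n) (Fin n) ℝ := (hH.eigenvectorUnitary : Matrix (Fin n) (Fin n) ℝ) with hV
  have hVV : V * star V = 1 := Unitary.coe_mul_star_self hH.eigenvectorUnitary
  have hinv : V⁻¹ = star V := inv_eq_right_inv hVV
  have hu : IsUnit V := IsUnit.of_mul_eq_one _ hVV
  have htr : X.trace = ∑ i, hH.eigenvalues i := by
    simpa using hH.trace_eq_sum_eigenvalues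
  rw [htr]
  generalize hH.eigenvalues = l at hs
  rw [hs, ← hinv, exp_conj V _ hu, det_conj hu, exp_diagonal, det_diagonal, Real.exp_sum]
  refine Finset.prod_congr rfl fun i _ => ?_
  simp [Pi.coe_exp, Real.exp_eq_exp_ℝ]

/-- `exp : Sym_n(ℝ) → GL_n(ℝ)`. -/
def expGL (X : Sym n) : GL (Fin n) ℝ := (Matrix.isUnit_exp (X : Matrix (Fin n) (Fin n) ℝ)).unit

/-- `exp : SSym_n(ℝ) → SL_n(ℝ)`. -/
def expSL (X : SSym n) : SpecialLinearGroup (Fin n) ℝ :=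
  ⟨NormedSpace.exp (X : Matrix (Fin n) (Fin n) ℝ), by
    have h : (X : Matrix (Fin n) (Fin n) ℝ).trace = 0 := X.2.2
    rw [det_exp_of_isSymm X.2.1, h, Real.exp_zero]⟩

attribute [local instance] Matrix.normedAddCommGroup Matrix.normedSpace

variable (n)

/-- The homogeneous space `GL_n(ℝ)/O_n(ℝ)`. -/
abbrev PosSpace : Type := GL (Fin n) ℝ ⧸ On n

/-- The homogeneous space `SL_n(ℝ)/SO_n(ℝ)`. -/
abbrev SPosSpace : Type := SpecialLinearGroup (Fin n) ℝ ⧸ SOn n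

/-- `C^∞(GL_n(ℝ)/O_n(ℝ))`. -/
abbrev SmoothPos : Submodule ℂ (PosSpace n → ℂ) := smoothFn (On n) (expGL (n := n))

/-- `C^∞(SL_n(ℝ)/SO_n(ℝ))`. -/
abbrev SmoothSPos : Submodule ℂ (SPosSpace n → ℂ) := smoothFn (SOn n) (expSL (n := n))

/-- `𝔻(GL_n(ℝ)/O_n(ℝ))`. -/
abbrev DPos : Subalgebra ℂ (Module.End ℂ (SmoothPos n)) := invDiffOp (On n) (expGL (n := n))

/-- `𝔻(SL_n(ℝ)/SO_n(ℝ))`. -/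
abbrev DSPos : Subalgebra ℂ (Module.End ℂ (SmoothSPos n)) := invDiffOp (SOn n) (expSL (n := n))

/-! ### The maps `i` and `p` -/

/-- `i : SL_n(ℝ)/SO_n(ℝ) → GL_n(ℝ)/O_n(ℝ)`, `g SO_n(ℝ) ↦ g O_n(ℝ)`. -/
def iMap : SPosSpace n → PosSpace n :=
  Quotient.map' (fun g => SpecialLinearGroup.toGL g) fun a b h => by
    rw [QuotientGroup.leftRel_apply] at h ⊢
    simpa [SOn] using h

/-- The identification `GL_n^+(ℝ)/SO_n(ℝ) → GL_n(ℝ)/O_n(ℝ)`, `g SO_n(ℝ) ↦ g O_n(ℝ)`. -/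
def identFun : GLPos (Fin n) ℝ ⧸ SOnPos n → PosSpace n :=
  Quotient.map' (fun g => g.1) fun a b h => by
    rw [QuotientGroup.leftRel_apply] at h ⊢
    exact h

variable [NeZero n]

lemma exists_On_det_neg : ∃ s : GL (Fin n) ℝ, s ∈ On n ∧
    (s : Matrix (Fin n) (Fin n) ℝ).det = -1 := by
  set d : Fin n → ℝ := Function.update 1 0 (-1) with hd
  have hdd : diagonal d * diagonal d = 1 := by
    rw [diagonal_mul_diagonal, ← diagonal_one]
    congr 1
    funext i
    by_cases h : i = 0
    · subst h; simp [hd]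
    · simp [hd, h]
  refine ⟨⟨diagonal d, diagonal d, hdd, hdd⟩, ?_, ?_⟩
  · change diagonal d ∈ orthogonalGroup (Fin n) ℝ
    rw [mem_orthogonalGroup_iff, diagonal_transpose]
    exact hdd
  · change (diagonal d).det = -1
    rw [det_diagonal, hd, Finset.prod_update_of_mem (Finset.mem_univ _)]
    simp

lemma identFun_bijective : Function.Bijective (identFun n) := by
  constructor
  · rintro ⟨a⟩ ⟨b⟩ h
    have h' := QuotientGroup.eq.1 (show (QuotientGroup.mk a.1 : PosSpace n) =
      QuotientGroup.mk b.1 from h)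
    exact QuotientGroup.eq.2 h'
  · rintro ⟨g⟩
    have hne : (g : Matrix (Fin n) (Fin n) ℝ).det ≠ 0 := g.det.ne_zero
    rcases lt_or_gt_of_ne hne with hlt | hgt
    · obtain ⟨s, hs, hdet⟩ := exists_On_det_neg n
      refine ⟨QuotientGroup.mk ⟨g * s, ?_⟩, ?_⟩
      · rw [mem_glpos]
        change 0 < ((g * s : GL (Fin n) ℝ) : Matrix (Fin n) (Fin n) ℝ).det
        rw [GeneralLinearGroup.coe_mul, det_mul, hdet]
        linarith
      · change (QuotientGroup.mk (g * s) : PosSpace n) = QuotientGroup.mk g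
        exact QuotientGroup.mk_mul_of_mem g hs
    · exact ⟨QuotientGroup.mk ⟨g, hgt⟩, rfl⟩

/-- The bijection `GL_n^+(ℝ)/SO_n(ℝ) ≃ GL_n(ℝ)/O_n(ℝ)`, `g SO_n(ℝ) ↦ g O_n(ℝ)`. -/
def ident : GLPos (Fin n) ℝ ⧸ SOnPos n ≃ PosSpace n := Equiv.ofBijective _ (identFun_bijective n)

variable {n} in
/-- `g ↦ det(g)^{-1/n} g`, from `GL_n^+(ℝ)` to `SL_n(ℝ)`. -/
def normalize (g : GLPos (Fin n) ℝ) : SpecialLinearGroup (Fin n) ℝ :=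
  ⟨((g.1 : Matrix (Fin n) (Fin n) ℝ).det ^ (-(1 / (n : ℝ)))) •
      (g.1 : Matrix (Fin n) (Fin n) ℝ), by
    have h : 0 < (g.1 : Matrix (Fin n) (Fin n) ℝ).det := g.2
    have hn : (n : ℝ) ≠ 0 := NeZero.ne _
    rw [det_smul, Fintype.card_fin, ← Real.rpow_natCast, ← Real.rpow_mul h.le, neg_mul,
      one_div_mul_cancel hn, Real.rpow_neg h.le, Real.rpow_one, inv_mul_cancel₀ h.ne']⟩

/-- `GL_n^+(ℝ)/SO_n(ℝ) → SL_n(ℝ)/SO_n(ℝ)`, `g SO_n(ℝ) ↦ det(g)^{-1/n} g SO_n(ℝ)`. -/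
def pPos : GLPos (Fin n) ℝ ⧸ SOnPos n → SPosSpace n :=
  Quotient.map' normalize fun a b h => by
    rw [QuotientGroup.leftRel_apply] at h ⊢
    have h1 : (((a⁻¹ * b : GLPos (Fin n) ℝ) : GL (Fin n) ℝ) : Matrix (Fin n) (Fin n) ℝ).det = 1 :=
      (mem_specialOrthogonalGroup_iff.1 ((mem_SOnPos_iff _).1 h)).2
    have hb : b = a * (a⁻¹ * b) := by group
    set k := a⁻¹ * b with hk
    have hdet : (b.1 : Matrix (Fin n) (Fin n) ℝ).det = (a.1 : Matrix (Fin n) (Fin n) ℝ).det := by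
      rw [hb, Subgroup.coe_mul, GeneralLinearGroup.coe_mul, det_mul, h1, mul_one]
    let k' : SpecialLinearGroup (Fin n) ℝ := ⟨(k.1 : Matrix (Fin n) (Fin n) ℝ), h1⟩
    have hbk : normalize b = normalize a * k' := by
      ext i j
      have h2 : (b.1 : Matrix (Fin n) (Fin n) ℝ) = a.1 * k.1 := by
        conv_lhs => rw [hb]
        rfl
      change (_ • (b.1 : Matrix (Fin n) (Fin n) ℝ)) i j =
        ((_ • (a.1 : Matrix (Fin n) (Fin n) ℝ)) * (k.1 : Matrix (Fin n) (Fin n) ℝ)) i j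
      rw [hdet, h2, smul_mul]
    rw [hbk, inv_mul_cancel_left, mem_SOn_iff]
    exact (mem_SOnPos_iff _).1 h

/-- `p : GL_n(ℝ)/O_n(ℝ) → SL_n(ℝ)/SO_n(ℝ)`, given by `g O_n(ℝ) ↦ det(g)^{-1/n} g SO_n(ℝ)` for
`det g > 0`. -/
def pMap : PosSpace n → SPosSpace n := fun x => pPos n ((ident n).symm x)

lemma pMap_mk (g : GLPos (Fin n) ℝ) :
    pMap n (QuotientGroup.mk g.1) = QuotientGroup.mk (normalize g) := by
  have h : (ident n).symm (QuotientGroup.mk g.1) = QuotientGroup.mk g := by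
    rw [Equiv.symm_apply_eq]
    rfl
  rw [pMap, h]
  rfl

/-- In the charts, `p` is the linear map `X ↦ X - (tr X / n) 1`, up to a conjugation. -/
lemma exists_pMap_chart (g : GL (Fin n) ℝ) :
    ∃ (h : SpecialLinearGroup (Fin n) ℝ) (L : Sym n →ₗ[ℝ] SSym n), ∀ X : Sym n,
      pMap n (QuotientGroup.mk (g * expGL X)) = QuotientGroup.mk (h * expSL (L X)) := by
  obtain ⟨s, hs, hpos⟩ : ∃ s ∈ On n, g * s ∈ GLPos (Fin n) ℝ := by
    obtain ⟨⟨a⟩, ha⟩ := (identFun_bijective n).2 (QuotientGroup.mk g)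
    have h' := QuotientGroup.eq.1 (show (QuotientGroup.mk g : PosSpace n) =
      QuotientGroup.mk a.1 from ha.symm)
    exact ⟨g⁻¹ * a.1, h', by simp⟩
  have hn : (n : ℝ) ≠ 0 := NeZero.ne _
  let S : Matrix (Fin n) (Fin n) ℝ := s
  have hSS : S * Sᵀ = 1 := (mem_orthogonalGroup_iff _ _).1 hs
  have hSu : IsUnit S := s.isUnit
  have hSinv : S⁻¹ = Sᵀ := inv_eq_right_inv hSS
  let M : Matrix (Fin n) (Fin n) ℝ →ₗ[ℝ] Matrix (Fin n) (Fin n) ℝ :=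
    { toFun := fun X => Sᵀ * X * S - (X.trace / n) • 1
      map_add' := fun X Y => by
        rw [trace_add, add_div, add_smul, mul_add, add_mul]
        abel
      map_smul' := fun c X => by
        simp [smul_sub, smul_smul, mul_div_assoc] }
  have hM : ∀ X : Sym n, M X ∈ SSym n := by
    intro X
    have hX : (X : Matrix (Fin n) (Fin n) ℝ)ᵀ = X := X.2
    refine ⟨?_, ?_⟩
    · change (Sᵀ * (X : Matrix (Fin n) (Fin n) ℝ) * S - _)ᵀ = _
      rw [transpose_sub, transpose_mul, transpose_mul, transpose_transpose, hX, transpose_smul,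
        transpose_one, ← mul_assoc]
      rfl
    · change (Sᵀ * (X : Matrix (Fin n) (Fin n) ℝ) * S - _).trace = 0
      rw [trace_sub, trace_mul_comm, ← mul_assoc, hSS, one_mul, trace_smul, trace_one]
      simp [hn]
  refine ⟨normalize ⟨g * s, hpos⟩, (M ∘ₗ (Sym n).subtype).codRestrict (SSym n) hM, fun X => ?_⟩
  let Y : Matrix (Fin n) (Fin n) ℝ := X
  have hY : Y.IsSymm := X.2
  have h0 : 0 < (((g * s : GL (Fin n) ℝ)) : Matrix (Fin n) (Fin n) ℝ).det := hpos
  have hdet : ((g * expGL X * s : GL (Fin n) ℝ) : Matrix (Fin n) (Fin n) ℝ).det =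
      (((g * s : GL (Fin n) ℝ)) : Matrix (Fin n) (Fin n) ℝ).det * Real.exp Y.trace := by
    rw [← det_exp_of_isSymm hY]
    simp only [GeneralLinearGroup.coe_mul, det_mul]
    change _ * (NormedSpace.exp Y).det * _ = _
    ring
  have hpos' : g * expGL X * s ∈ GLPos (Fin n) ℝ := by
    rw [mem_glpos]
    change 0 < ((g * expGL X * s : GL (Fin n) ℝ) : Matrix (Fin n) (Fin n) ℝ).det
    rw [hdet]
    positivity
  have h1 : (QuotientGroup.mk (g * expGL X) : PosSpace n) = QuotientGroup.mk (g * expGL X * s) :=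
    (QuotientGroup.mk_mul_of_mem _ hs).symm
  rw [h1, pMap_mk n ⟨g * expGL X * s, hpos'⟩]
  congr 1
  have hexp : NormedSpace.exp (M Y) =
      Real.exp (-(1 / (n : ℝ)) * Y.trace) • (Sᵀ * NormedSpace.exp Y * S) := by
    have e1 : M Y = S⁻¹ * Y * S + algebraMap ℝ (Matrix (Fin n) (Fin n) ℝ)
        (-(1 / (n : ℝ)) * Y.trace) := by
      change Sᵀ * Y * S - (Y.trace / n) • (1 : Matrix (Fin n) (Fin n) ℝ) = _
      rw [hSinv, Algebra.algebraMap_eq_smul_one, sub_eq_add_neg, ← neg_smul]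
      congr 2
      ring
    rw [e1, Matrix.exp_add_of_commute _ _ (Algebra.commute_algebraMap_right _ _), exp_conj' S Y hSu, hSinv,
      algebraMap_eq_diagonal, exp_diagonal]
    have e2 : diagonal (NormedSpace.exp (algebraMap ℝ (Fin n → ℝ) (-(1 / (n : ℝ)) * Y.trace))) =
        Real.exp (-(1 / (n : ℝ)) * Y.trace) • (1 : Matrix (Fin n) (Fin n) ℝ) := by
      rw [smul_one_eq_diagonal]
      congr 1
      funext i
      simp [Pi.coe_exp, Real.exp_eq_exp_ℝ]
    rw [e2, Matrix.mul_smul, mul_one]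
  have key : (((g * expGL X * s : GL (Fin n) ℝ) : Matrix (Fin n) (Fin n) ℝ).det ^
        (-(1 / (n : ℝ)))) • ((g * expGL X * s : GL (Fin n) ℝ) : Matrix (Fin n) (Fin n) ℝ) =
      ((((g * s : GL (Fin n) ℝ) : Matrix (Fin n) (Fin n) ℝ).det ^ (-(1 / (n : ℝ)))) •
        ((g * s : GL (Fin n) ℝ) : Matrix (Fin n) (Fin n) ℝ)) * NormedSpace.exp (M Y) := by
    rw [hdet, Real.mul_rpow h0.le (Real.exp_pos _).le, ← Real.exp_mul, hexp, smul_mul_smul_comm,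
      mul_comm Y.trace]
    congr 1
    simp only [GeneralLinearGroup.coe_mul]
    change _ * NormedSpace.exp Y * S = _ * S * (Sᵀ * NormedSpace.exp Y * S)
    simp only [← mul_assoc]
    rw [mul_assoc _ S Sᵀ, hSS, mul_one]
  exact Subtype.ext key

/-- `f ∘ p` is smooth for smooth `f`. -/
lemma comp_pMap_mem (f : SmoothSPos n) : f.1 ∘ pMap n ∈ SmoothPos n := by
  intro g
  obtain ⟨h, L, hL⟩ := exists_pMap_chart n g
  simp only [Function.comp_apply, hL]
  exact (f.2 h).comp L.toContinuousLinearMap.contDiff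

/-- `p^* f = f ∘ p`. -/
def compP (f : SmoothSPos n) : SmoothPos n := ⟨f.1 ∘ pMap n, comp_pMap_mem n f⟩

end Groups

end SymmetricSpace

end

open Matrix

attribute [local instance] Matrix.normedAddCommGroup Matrix.normedSpace

noncomputable section

namespace SymmetricSpace

/-! The map `i` is a section of `p`, and `i (p x)` is a translate of `x` by a positive scalar
matrix. A function `f ∘ p` is fixed by translation by positive scalars. An invariant `D` commutes
with these translations, so `D (f ∘ p)` is fixed by them too, and therefore equals its own
restriction along `i` pulled back along `p` (`compP_compI_apply`). This is the second formula. It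
also gives multiplicativity: in `i^* D D' p^*` one may insert `p^* i^*` between `D` and `D'`,
because it fixes the image of `D' p^*`. The unit is preserved because `i^* p^* = id`.

It remains to see that `i^* D p^*` lies in the target algebra. Its invariance holds because `i` and
`p` are equivariant under `SL_n(ℝ)`. That it is a differential operator is seen in the exponential
charts centred at points of `SL_n(ℝ)`: there `i` is the linear inclusion of the trace zero symmetric
matrices and `p` is the linear projection removing the trace, since `exp X` is `exp (tr X / n)`
times the exponential of the trace zero part. `IsPDOOn.comp_linear` then transports a local
expression of `D`. -/

/-! ### Differential operators and linear retractions -/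

/-- Pulling back a differential operator along a linear map `j` which has a linear left inverse `r`:
if `ev f = ev' f ∘ r`, then `T ∘ j` is a differential operator in terms of `ev'`. -/
lemma IsPDOOn.comp_linear {E F S : Type*} [NormedAddCommGroup E] [NormedSpace ℝ E]
    [NormedAddCommGroup F] [NormedSpace ℝ F] {U : Set E} {ev T : S → E → ℂ} {ev' : S → F → ℂ}
    (h : IsPDOOn U ev T) (j : F →L[ℝ] E) (r : E →L[ℝ] F) (hr : ∀ X, r (j X) = X)
    (hev' : ∀ f, ContDiff ℝ ∞ (ev' f)) (hev : ∀ f, ev f = ev' f ∘ r) :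
    IsPDOOn (j ⁻¹' U) ev' (fun f X => T f (j X)) := by
  obtain ⟨m, d, a, ha, hT⟩ := h
  -- By the chain rule for the linear map `r`, differentiating `ev' f ∘ r` along `v` is
  -- differentiating `ev' f` along `r v`. So the orders stay, the directions are pushed forward by
  -- `r`, and the coefficients are restricted along `j`.
  refine ⟨m, fun i => ⟨(d i).1, fun l => r ((d i).2 l)⟩, fun i X => a i (j X),
    fun i => (ha i).comp j.contDiff.contDiffOn fun _ hX => hX, fun f X hX => ?_⟩
  refine (hT f (j X) hX).trans ?_
  refine Finset.sum_congr rfl fun i _ => ?_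
  have hk : (((d i).1 : ℕ) : WithTop ℕ∞) ≤ ∞ := by exact_mod_cast le_top
  rw [hev f, r.iteratedFDeriv_comp_right (hev' f) (j X) hk, hr]
  rfl

variable (n : ℕ)

/-! ### Restriction along `i` -/

/-- The inclusion of the trace zero symmetric matrices into the symmetric matrices. -/
def inclSym : SSym n →L[ℝ] Sym n :=
  LinearMap.toContinuousLinearMap (Submodule.inclusion (inf_le_left : SSym n ≤ Sym n))

lemma toGL_expSL (X : SSym n) : SpecialLinearGroup.toGL (expSL X) = expGL (inclSym n X) :=
  Units.ext rfl

lemma iMap_mk (g : SpecialLinearGroup (Fin n) ℝ) :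
    iMap n (QuotientGroup.mk g) = QuotientGroup.mk (SpecialLinearGroup.toGL g) := rfl

lemma iMap_smul (g : SpecialLinearGroup (Fin n) ℝ) (x : SPosSpace n) :
    iMap n (g • x) = SpecialLinearGroup.toGL g • iMap n x := by
  induction x using QuotientGroup.induction_on with
  | H h =>
    change (QuotientGroup.mk (SpecialLinearGroup.toGL (g * h)) : PosSpace n) =
      QuotientGroup.mk (SpecialLinearGroup.toGL g * SpecialLinearGroup.toGL h)
    rw [map_mul]

/-- `i^* F = F ∘ i`, as a linear map. -/
def compI : SmoothPos n →ₗ[ℂ] SmoothSPos n where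
  toFun F := ⟨F.1 ∘ iMap n, fun g => by
    have h := (F.2 (SpecialLinearGroup.toGL g)).comp (inclSym n).contDiff
    refine (congrArg (ContDiff ℝ ∞) (funext fun X => ?_)).mp h
    refine congrArg F.1 ?_
    rw [iMap_mk, map_mul, toGL_expSL]
    rfl⟩
  map_add' _ _ := rfl
  map_smul' _ _ := rfl

lemma compI_apply (F : SmoothPos n) (x : SPosSpace n) : (compI n F).1 x = F.1 (iMap n x) := rfl

/-- In the exponential charts at `g`, the map `i` is the linear inclusion, because both exponentials
are the matrix exponential. -/
lemma inChart_compI (g : SpecialLinearGroup (Fin n) ℝ) (F : SmoothPos n) (X : SSym n) :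
    inChart (SOn n) expSL g (compI n F) X =
      inChart (On n) expGL (SpecialLinearGroup.toGL g) F (inclSym n X) := by
  simp only [inChart, compI_apply, iMap_mk, map_mul, toGL_expSL]

lemma compI_translate (g : SpecialLinearGroup (Fin n) ℝ) (F : SmoothPos n) :
    compI n (translate (On n) expGL (SpecialLinearGroup.toGL g) F) =
      translate (SOn n) expSL g (compI n F) := by
  ext x
  change F.1 (SpecialLinearGroup.toGL g • iMap n x) = F.1 (iMap n (g • x))
  rw [iMap_smul]

/-! ### Positive scalars and the equivariance of `p` -/

/-- The scalar matrix `r` as an element of `GL_n(ℝ)`. -/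
def scalarGL : ℝˣ →* GL (Fin n) ℝ :=
  Units.map (algebraMap ℝ (Matrix (Fin n) (Fin n) ℝ) : ℝ →* Matrix (Fin n) (Fin n) ℝ)

lemma coe_scalarGL_mul (r : ℝˣ) (g : GL (Fin n) ℝ) :
    ((scalarGL n r * g : GL (Fin n) ℝ) : Matrix (Fin n) (Fin n) ℝ) =
      (r : ℝ) • (g : Matrix (Fin n) (Fin n) ℝ) := by
  change algebraMap ℝ (Matrix (Fin n) (Fin n) ℝ) (r : ℝ) * (g : Matrix (Fin n) (Fin n) ℝ) = _
  rw [Algebra.smul_def]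

variable [NeZero n]

lemma exists_mk_glpos (x : PosSpace n) :
    ∃ g : GLPos (Fin n) ℝ, (QuotientGroup.mk g.1 : PosSpace n) = x := by
  obtain ⟨⟨a⟩, ha⟩ := (identFun_bijective n).2 x
  exact ⟨a, ha⟩

/-- Scaling by `r` multiplies the determinant by `r ^ n`, so the normalizing factor acquires `r⁻¹`,
which cancels the scaling. -/
lemma pMap_scalar_smul {r : ℝˣ} (hr : 0 < (r : ℝ)) (x : PosSpace n) :
    pMap n (scalarGL n r • x) = pMap n x := by
  obtain ⟨g, rfl⟩ := exists_mk_glpos n x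
  have hg : 0 < (g.1 : Matrix (Fin n) (Fin n) ℝ).det := g.2
  have hn : (n : ℝ) ≠ 0 := NeZero.ne _
  have hdet : ((scalarGL n r * g.1 : GL (Fin n) ℝ) : Matrix (Fin n) (Fin n) ℝ).det =
      (r : ℝ) ^ n * (g.1 : Matrix (Fin n) (Fin n) ℝ).det := by
    rw [coe_scalarGL_mul, det_smul, Fintype.card_fin]
  have hpos : scalarGL n r * g.1 ∈ GLPos (Fin n) ℝ := by
    rw [mem_glpos]
    change 0 < ((scalarGL n r * g.1 : GL (Fin n) ℝ) : Matrix (Fin n) (Fin n) ℝ).det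
    rw [hdet]
    positivity
  change pMap n (QuotientGroup.mk (⟨scalarGL n r * g.1, hpos⟩ : GLPos (Fin n) ℝ).1) = _
  rw [pMap_mk, pMap_mk]
  congr 1
  refine Subtype.ext ?_
  change ((scalarGL n r * g.1 : GL (Fin n) ℝ) : Matrix (Fin n) (Fin n) ℝ).det ^
    (-(1 / (n : ℝ))) • ((scalarGL n r * g.1 : GL (Fin n) ℝ) : Matrix (Fin n) (Fin n) ℝ) =
      (g.1 : Matrix (Fin n) (Fin n) ℝ).det ^ (-(1 / (n : ℝ))) • (g.1 : Matrix (Fin n) (Fin n) ℝ)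
  rw [hdet, coe_scalarGL_mul, smul_smul, Real.mul_rpow (by positivity) hg.le,
    ← Real.rpow_natCast, ← Real.rpow_mul hr.le, mul_neg, mul_one_div_cancel hn,
    Real.rpow_neg_one, mul_right_comm, inv_mul_cancel₀ hr.ne', one_mul]

/-- Since `det h = 1`, the representatives `g` and `h * g` have the same normalizing factor, and
this scalar commutes with `h`. -/
lemma pMap_toGL_smul (h : SpecialLinearGroup (Fin n) ℝ) (x : PosSpace n) :
    pMap n (SpecialLinearGroup.toGL h • x) = h • pMap n x := by
  obtain ⟨g, rfl⟩ := exists_mk_glpos n x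
  have hdet : ((SpecialLinearGroup.toGL h * g.1 : GL (Fin n) ℝ) : Matrix (Fin n) (Fin n) ℝ).det =
      (g.1 : Matrix (Fin n) (Fin n) ℝ).det := by
    rw [GeneralLinearGroup.coe_mul, det_mul]
    change (h : Matrix (Fin n) (Fin n) ℝ).det * _ = _
    rw [h.2, one_mul]
  have hpos : SpecialLinearGroup.toGL h * g.1 ∈ GLPos (Fin n) ℝ := by
    rw [mem_glpos]
    change 0 < ((SpecialLinearGroup.toGL h * g.1 : GL (Fin n) ℝ) :
      Matrix (Fin n) (Fin n) ℝ).det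
    rw [hdet]
    exact g.2
  change pMap n (QuotientGroup.mk (⟨SpecialLinearGroup.toGL h * g.1, hpos⟩ :
    GLPos (Fin n) ℝ).1) = _
  rw [pMap_mk, pMap_mk]
  change _ = (QuotientGroup.mk (h * normalize g) : SPosSpace n)
  congr 1
  refine Subtype.ext ?_
  change ((SpecialLinearGroup.toGL h * g.1 : GL (Fin n) ℝ) : Matrix (Fin n) (Fin n) ℝ).det ^
    (-(1 / (n : ℝ))) • ((h : Matrix (Fin n) (Fin n) ℝ) * (g.1 : Matrix (Fin n) (Fin n) ℝ)) =
      (h : Matrix (Fin n) (Fin n) ℝ) *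
        ((g.1 : Matrix (Fin n) (Fin n) ℝ).det ^ (-(1 / (n : ℝ))) •
          (g.1 : Matrix (Fin n) (Fin n) ℝ))
  rw [hdet, Matrix.mul_smul]

lemma pMap_iMap (x : SPosSpace n) : pMap n (iMap n x) = x := by
  induction x using QuotientGroup.induction_on with
  | H h =>
    have hdet : (h : Matrix (Fin n) (Fin n) ℝ).det = 1 := h.2
    have hpos : SpecialLinearGroup.toGL h ∈ GLPos (Fin n) ℝ := by
      rw [mem_glpos]
      change 0 < (h : Matrix (Fin n) (Fin n) ℝ).det
      rw [hdet]
      exact one_pos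
    change pMap n (QuotientGroup.mk (⟨SpecialLinearGroup.toGL h, hpos⟩ : GLPos (Fin n) ℝ).1) = _
    rw [pMap_mk]
    congr 1
    refine Subtype.ext ?_
    change (h : Matrix (Fin n) (Fin n) ℝ).det ^ (-(1 / (n : ℝ))) •
      (h : Matrix (Fin n) (Fin n) ℝ) = h
    rw [hdet, Real.one_rpow, one_smul]

/-- The point `i (p x)` differs from `x` by a positive scalar. -/
lemma exists_iMap_pMap (x : PosSpace n) :
    ∃ r : ℝˣ, 0 < (r : ℝ) ∧ iMap n (pMap n x) = scalarGL n r • x := by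
  obtain ⟨g, rfl⟩ := exists_mk_glpos n x
  have hg : 0 < (g.1 : Matrix (Fin n) (Fin n) ℝ).det := g.2
  have hr := Real.rpow_pos_of_pos hg (-(1 / (n : ℝ)))
  -- The scalar is the normalizing factor `det(g)^{-1/n}` of a representative with positive
  -- determinant.
  refine ⟨Units.mk0 _ hr.ne', hr, ?_⟩
  rw [pMap_mk, iMap_mk]
  change _ = (QuotientGroup.mk (scalarGL n _ * g.1) : PosSpace n)
  congr 1
  refine Units.ext ?_
  rw [coe_scalarGL_mul]
  rfl

/-! ### The map `p` in the exponential charts -/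

/-- The projection `X ↦ X - (tr X / n) 1` of the symmetric matrices onto those of trace zero. -/
def projSym : Sym n →L[ℝ] SSym n :=
  LinearMap.toContinuousLinearMap <|
    ((Sym n).subtype - ((n : ℝ)⁻¹ • (traceLinearMap (Fin n) ℝ ℝ ∘ₗ (Sym n).subtype)).smulRight
      (1 : Matrix (Fin n) (Fin n) ℝ)).codRestrict (SSym n) fun X => by
        have hn : (n : ℝ) ≠ 0 := NeZero.ne _
        refine ⟨(Sym n).sub_mem X.2 ((Sym n).smul_mem _ isSymm_one), ?_⟩
        simp
        field_simp
        ring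

lemma coe_projSym (X : Sym n) : (projSym n X : Matrix (Fin n) (Fin n) ℝ) =
    X - ((n : ℝ)⁻¹ * (X : Matrix (Fin n) (Fin n) ℝ).trace) • 1 := rfl

lemma projSym_inclSym (X : SSym n) : projSym n (inclSym n X) = X := by
  refine Subtype.ext ?_
  have h : (X : Matrix (Fin n) (Fin n) ℝ).trace = 0 := X.2.2
  rw [coe_projSym]
  change (X : Matrix (Fin n) (Fin n) ℝ) -
    ((n : ℝ)⁻¹ * (X : Matrix (Fin n) (Fin n) ℝ).trace) • 1 = X
  rw [h, mul_zero, zero_smul, sub_zero]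

/-- `exp X` is a positive scalar multiple of the exponential of the trace zero part of `X`. -/
lemma exists_expGL_eq (X : Sym n) :
    ∃ r : ℝˣ, 0 < (r : ℝ) ∧
      expGL X = scalarGL n r * SpecialLinearGroup.toGL (expSL (projSym n X)) := by
  -- `X` is the sum of the scalar matrix `c` and its trace zero part. These commute, so the
  -- exponential splits as a product.
  set c : ℝ := (n : ℝ)⁻¹ * (X : Matrix (Fin n) (Fin n) ℝ).trace with hc
  refine ⟨Units.mk0 (Real.exp c) (Real.exp_pos c).ne', Real.exp_pos c, Units.ext ?_⟩
  rw [coe_scalarGL_mul]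
  change NormedSpace.exp (X : Matrix (Fin n) (Fin n) ℝ) =
    Real.exp c • NormedSpace.exp (projSym n X : Matrix (Fin n) (Fin n) ℝ)
  have hX : (X : Matrix (Fin n) (Fin n) ℝ) =
      algebraMap ℝ (Matrix (Fin n) (Fin n) ℝ) c + (projSym n X : Matrix (Fin n) (Fin n) ℝ) := by
    rw [coe_projSym, Algebra.algebraMap_eq_smul_one, ← hc]
    abel
  have hs : NormedSpace.exp (algebraMap ℝ (Matrix (Fin n) (Fin n) ℝ) c) =
      Real.exp c • (1 : Matrix (Fin n) (Fin n) ℝ) := by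
    rw [algebraMap_eq_diagonal, exp_diagonal, smul_one_eq_diagonal]
    congr 1
    funext i
    simp [Pi.coe_exp, Real.exp_eq_exp_ℝ]
  conv_lhs => rw [hX]
  rw [Matrix.exp_add_of_commute _ _ (Algebra.commute_algebraMap_left _ _), hs, smul_mul, one_mul]

/-- At centres in `SL_n(ℝ)` the chart expression of `p` is `projSym` itself, with no conjugation.
This makes it a left inverse of the chart expression `inclSym` of `i`. -/
lemma pMap_mk_toGL_mul_expGL (g : SpecialLinearGroup (Fin n) ℝ) (X : Sym n) :
    pMap n (QuotientGroup.mk (SpecialLinearGroup.toGL g * expGL X)) =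
      QuotientGroup.mk (g * expSL (projSym n X)) := by
  obtain ⟨r, hr, h⟩ := exists_expGL_eq n X
  change pMap n (SpecialLinearGroup.toGL g • (QuotientGroup.mk (expGL X) : PosSpace n)) = _
  rw [pMap_toGL_smul, h]
  -- The trace zero factor is a point in the image of `i`, so once the scalar is dropped `p ∘ i =
  -- id` finishes.
  change g • pMap n (scalarGL n r • iMap n (QuotientGroup.mk (expSL (projSym n X)))) = _
  rw [pMap_scalar_smul n hr, pMap_iMap]
  rfl

lemma inChart_compP (g : SpecialLinearGroup (Fin n) ℝ) (f : SmoothSPos n) :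
    inChart (On n) expGL (SpecialLinearGroup.toGL g) (compP n f) =
      inChart (SOn n) expSL g f ∘ projSym n :=
  funext fun X => congrArg f.1 (pMap_mk_toGL_mul_expGL n g X)

/-! ### Pullback along `p` -/

/-- `p^* f = f ∘ p`, as a linear map. -/
def compPLinear : SmoothSPos n →ₗ[ℂ] SmoothPos n where
  toFun := compP n
  map_add' _ _ := rfl
  map_smul' _ _ := rfl

lemma compI_compP (f : SmoothSPos n) : compI n (compP n f) = f :=
  Subtype.ext <| funext fun x => congrArg f.1 (pMap_iMap n x)

lemma compP_translate (g : SpecialLinearGroup (Fin n) ℝ) (f : SmoothSPos n) :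
    compP n (translate (SOn n) expSL g f) =
      translate (On n) expGL (SpecialLinearGroup.toGL g) (compP n f) :=
  Subtype.ext <| funext fun x => congrArg f.1 (pMap_toGL_smul n g x).symm

lemma translate_scalar_compP {r : ℝˣ} (hr : 0 < (r : ℝ)) (f : SmoothSPos n) :
    translate (On n) expGL (scalarGL n r) (compP n f) = compP n f :=
  Subtype.ext <| funext fun x => congrArg f.1 (pMap_scalar_smul n hr x)

/-! ### Descent of invariant operators -/

/-- For an invariant operator `D`, the function `D (f ∘ p)` is the pullback along `p` of its own
restriction along `i`. -/
lemma compP_compI_apply (D : DPos n) (f : SmoothSPos n) :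
    compP n (compI n (D.1 (compP n f))) = D.1 (compP n f) := by
  refine Subtype.ext <| funext fun x => ?_
  obtain ⟨r, hr, h⟩ := exists_iMap_pMap n x
  change (D.1 (compP n f)).1 (iMap n (pMap n x)) = _
  -- This is where invariance under all of `GL_n(ℝ)`, and not only `SL_n(ℝ)`, is used: `D` commutes
  -- with translation by the scalar.
  have h1 := D.2.2 (scalarGL n r) (compP n f)
  rw [translate_scalar_compP n hr] at h1
  rw [h]
  exact (congrArg (fun F : SmoothPos n => F.1 x) h1).symm

lemma isDiffOp_compI_compP (D : DPos n) :
    IsDiffOp (SOn n) expSL (compI n ∘ₗ D.1 ∘ₗ compPLinear n) := by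
  intro g
  obtain ⟨U, hU, h0, m, d, a, ha, hT⟩ := D.2.1 (SpecialLinearGroup.toGL g)
  -- The local expression of `D` is evaluated only on the functions `f ∘ p`, so that it becomes an
  -- operator with argument `f`.
  have h : IsPDOOn U
      (fun f : SmoothSPos n => inChart (On n) expGL (SpecialLinearGroup.toGL g) (compP n f))
      (fun f => inChart (On n) expGL (SpecialLinearGroup.toGL g) (D.1 (compP n f))) :=
    ⟨m, d, a, ha, fun f => hT (compP n f)⟩
  refine ⟨inclSym n ⁻¹' U, hU.preimage (inclSym n).continuous, ?_,
    (h.comp_linear (inclSym n) (projSym n) (projSym_inclSym n)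
      (contDiff_inChart (SOn n) expSL g) (inChart_compP n g)).congr fun f X _ =>
        inChart_compI n g (D.1 (compP n f)) X⟩
  rwa [Set.mem_preimage, map_zero]

/-- The morphism `P : 𝔻(GL_n(ℝ)/O_n(ℝ)) → 𝔻(SL_n(ℝ)/SO_n(ℝ))`, `P(D) f = D (f ∘ p) ∘ i`. -/
def restrictDiffOp : DPos n →ₐ[ℂ] DSPos n :=
  AlgHom.ofLinearMap
    { toFun := fun D => ⟨compI n ∘ₗ D.1 ∘ₗ compPLinear n, isDiffOp_compI_compP n D, fun g f => by
        change compI n (D.1 (compP n (translate (SOn n) expSL g f))) = _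
        rw [compP_translate, D.2.2, compI_translate]
        rfl⟩
      map_add' := fun _ _ => rfl
      map_smul' := fun _ _ => rfl }
    (Subtype.ext <| LinearMap.ext fun f => compI_compP n f)
    (fun D D' => Subtype.ext <| LinearMap.ext fun f => by
      change compI n (D.1 (D'.1 (compP n f))) =
        compI n (D.1 (compP n (compI n (D'.1 (compP n f)))))
      -- `p^* i^*` fixes `D' (f ∘ p)`, so the two compositions agree.
      rw [compP_compI_apply])

end SymmetricSpace

end

theorem mainTheorem4 (n : ℕ) [NeZero n] :
    ∃ P : SymmetricSpace.DPos n →ₐ[ℂ] SymmetricSpace.DSPos n,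
      (∀ (D : SymmetricSpace.DPos n) (f : SymmetricSpace.SmoothSPos n),
        ((P D).1 f).1 = (D.1 (SymmetricSpace.compP n f)).1 ∘ SymmetricSpace.iMap n) ∧
      (∀ (D : SymmetricSpace.DPos n) (f : SymmetricSpace.SmoothSPos n),
        ((P D).1 f).1 ∘ SymmetricSpace.pMap n = (D.1 (SymmetricSpace.compP n f)).1) := by
  exact ⟨SymmetricSpace.restrictDiffOp n, fun _ _ => rfl,
    fun D f => congrArg Subtype.val (SymmetricSpace.compP_compI_apply n D f)⟩
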